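/- Let $\mathbb{F}_q$ be a finite field with $q$ elements, where $q \equiv 1 \pmod 4$. Multiplicative characters $\mathbb{F}_q^* \to \mathbb{C}^*$ are extended to $\mathbb{F}_q$ by mapping $0$ to $0$ (the trivial character $\varepsilon$ included); $\overline{A}$ denotes the complex conjugate (the inverse) of a character $A$, and $\phi$ denotes the quadratic character. For characters $A, B, C$ and $x \in \mathbb{F}_q$ put $$ {}_2F_1\left( A, B;\, C \,\middle|\, x \right) = \frac{\varepsilon(x)}{q} \sum_{y \in \mathbb{F}_q} B(y)\, (\overline{B} C)(y-1)\, \overline{A}(1-xy). $$ Then there exists a quartic character on $\mathbb{F}_q$ (a multiplicative character of order exactly $4$), and for every quartic character $\chi_4$, every $z \in \mathbb{F}_q$ with $z \notin \{0, 1, -1\}$, and every multiplicative character $D$ on $\mathbb{F}_q$, $$ D^4(z-1)\; {}_2F_1\left( D, D\chi_4;\, \chi_4 \,\middle|\, z^4 \right) = {}_2F_1\left( D, D^2\phi;\, D\phi \,\middle|\, -\left(\frac{z+1}{z-1}\right)^2 \right). $$ -/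

import Mathlib

/-- The quadratic character `φ` of a finite field `F`, with complex values. -/
noncomputable def phiChar (F : Type*) [Field F] [Fintype F] [DecidableEq F] : MulChar F ℂ :=
  (quadraticChar F).ringHomComp (Int.castRingHom ℂ)

/-- The hypergeometric function `₂F₁(A, B; C | x)` over the finite field `F` with `q` elements,
`(ε(x) / q) * ∑ y, B(y) * (B⁻¹C)(y - 1) * A⁻¹(1 - x y)`. Multiplicative characters vanish at `0`,
the trivial one `ε = 1` included; `A⁻¹` is the complex conjugate character of `A`. -/
noncomputable def hyp2F1 {F : Type*} [Field F] [Fintype F] (A B C : MulChar F ℂ) (x : F) : ℂ :=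
  (1 : MulChar F ℂ) x / (Fintype.card F : ℂ) *
    ∑ y : F, B y * (B⁻¹ * C) (y - 1) * A⁻¹ (1 - x * y)

/-! Both sides reduce to one sum over `s`, with weight `phiChar F (s + 2)` and `D⁻¹` of a multiple
of `(z + z⁻¹) ^ 2 - s ^ 2`. On the right a Möbius substitution suffices (`quadratic_hyp2F1_sum`). On
the left, `v = z ^ 2 * y` gives a sum of `χ v * f (v + v⁻¹)` (`quartic_hyp2F1_sum`), and
`sum_quartic_comp_add_inv` trades `χ` for `φ`: computing `∑ φ(w) f((w + w⁻¹)² - 2)` through `v = w²`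
and through `s = w + w⁻¹` gives twice each of its sides. -/

theorem ringChar_ne_two_of_card_mod_four {F : Type*} [Field F] [Fintype F]
    (hq : Fintype.card F % 4 = 1) : ringChar F ≠ 2 := by
  intro h
  have := FiniteField.even_card_of_char_two h
  omega

theorem exists_mulChar_orderOf_eq_four (F : Type*) [Field F] [Fintype F]
    (hq : Fintype.card F % 4 = 1) :
    ∃ χ : MulChar F ℂ, orderOf χ = 4 :=
  MulChar.exists_mulChar_orderOf F (by omega) (Complex.isPrimitiveRoot_exp 4 (by norm_num))

section QuadraticCharacter

variable {F : Type*} [Field F] [Fintype F] [DecidableEq F]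

theorem phiChar_apply (a : F) : phiChar F a = (quadraticChar F a : ℂ) := rfl

theorem phiChar_sq {a : F} (ha : a ≠ 0) : phiChar F (a ^ 2) = 1 := by
  rw [phiChar_apply, quadraticChar_sq_one' ha, Int.cast_one]

theorem phiChar_mul_self {a : F} (ha : a ≠ 0) : phiChar F a * phiChar F a = 1 := by
  rw [← map_mul, ← sq, phiChar_sq ha]

theorem phiChar_inv (a : F) : phiChar F a⁻¹ = phiChar F a := by
  rcases eq_or_ne a 0 with rfl | ha
  · simp
  · have h : a⁻¹ = a * (a⁻¹) ^ 2 := by field_simp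
    rw [h, map_mul, phiChar_sq (inv_ne_zero ha), mul_one]

theorem phiChar_neg_one (hq : Fintype.card F % 4 = 1) : phiChar F (-1) = 1 := by
  have h : IsSquare (-1 : F) := FiniteField.isSquare_neg_one_iff.mpr (by omega)
  rw [phiChar_apply, (quadraticChar_one_iff_isSquare (neg_ne_zero.mpr one_ne_zero)).mpr h,
    Int.cast_one]

theorem phiChar_neg (hq : Fintype.card F % 4 = 1) (a : F) : phiChar F (-a) = phiChar F a := by
  rw [← neg_one_mul, map_mul, phiChar_neg_one hq, one_mul]

theorem card_sqrts_eq_phiChar (hF : ringChar F ≠ 2) (a : F) :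
    ((Finset.univ.filter fun x : F => x ^ 2 = a).card : ℂ) = 1 + phiChar F a := by
  have h := quadraticChar_card_sqrts hF a
  rw [Set.toFinset_ofPred] at h
  rw [phiChar_apply, add_comm]
  exact_mod_cast h

/-- A multiplicative character of order four squares to the quadratic character. -/
theorem sq_eq_phiChar_of_orderOf_eq_four {χ : MulChar F ℂ} (hχ : orderOf χ = 4) :
    χ ^ 2 = phiChar F := by
  have h4 : χ ^ 4 = 1 := hχ ▸ pow_orderOf_eq_one χ
  have h2 : χ ^ 2 ≠ 1 := fun h => by
    have := orderOf_dvd_of_pow_eq_one h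
    rw [hχ] at this
    omega
  have hsq : ∀ {b : F}, b ≠ 0 → IsSquare b → (χ ^ 2) b = 1 := by
    rintro b hb ⟨c, rfl⟩
    have hc : c ≠ 0 := left_ne_zero_of_mul hb
    rw [← sq, map_pow, ← MulChar.pow_apply' _ two_ne_zero, ← pow_mul, h4,
      MulChar.one_apply hc.isUnit]
  obtain ⟨u, hu⟩ := MulChar.ne_one_iff.mp h2
  have hu1 : (χ ^ 2) (u : F) = -1 := by
    have : (χ ^ 2) (u : F) * (χ ^ 2) (u : F) = 1 := by
      rw [← map_mul]
      exact hsq (mul_ne_zero u.ne_zero u.ne_zero) ⟨_, rfl⟩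
    exact (mul_self_eq_one_iff.mp this).resolve_left hu
  have hun : quadraticChar F (u : F) = -1 :=
    quadraticChar_neg_one_iff_not_isSquare.mpr fun h => hu (hsq u.ne_zero h)
  ext a
  rw [phiChar_apply]
  rcases quadraticChar_dichotomy a.ne_zero with h | h
  · rw [h, hsq a.ne_zero ((quadraticChar_one_iff_isSquare a.ne_zero).mp h), Int.cast_one]
  · have hm : IsSquare ((u : F) * a) := by
      rw [← quadraticChar_one_iff_isSquare (mul_ne_zero u.ne_zero a.ne_zero), map_mul, hun, h]
      norm_num
    have := hsq (mul_ne_zero u.ne_zero a.ne_zero) hm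
    rw [map_mul, hu1] at this
    rw [h, Int.cast_neg, Int.cast_one]
    linear_combination -this

theorem sum_comp_sq (hF : ringChar F ≠ 2) (h : F → ℂ) :
    ∑ w, h (w ^ 2) = ∑ v, (1 + phiChar F v) * h v := by
  rw [← Finset.sum_fiberwise Finset.univ (fun w : F => w ^ 2)]
  refine Finset.sum_congr rfl fun v _ => ?_
  rw [← card_sqrts_eq_phiChar hF, ← nsmul_eq_mul]
  refine Finset.sum_eq_card_nsmul fun w hw => ?_
  rw [(Finset.mem_filter.mp hw).2]

/-- The fibre of `w ↦ w + w⁻¹` over `s`, weighted by the quadratic character. -/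
theorem sum_phiChar_fiber_add_inv (hq : Fintype.card F % 4 = 1) (s : F) :
    ∑ w with w + w⁻¹ = s, phiChar F w = phiChar F (s + 2) + phiChar F (s - 2) := by
  have hF := ringChar_ne_two_of_card_mod_four hq
  have h2 : (2 : F) ≠ 0 := Ring.two_ne_zero hF
  have h4 : phiChar F 4 = 1 := by
    rw [show (4 : F) = 2 ^ 2 by norm_num, phiChar_sq h2]
  -- With `0⁻¹ = 0`, the point `w = 0` lies in the fibre of `s = 0`, but `φ(0) = 0`.
  have key : ∑ w with w + w⁻¹ = s, phiChar F w = ∑ w with w ^ 2 - s * w + 1 = 0, phiChar F w := by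
    rw [Finset.sum_filter, Finset.sum_filter]
    refine Finset.sum_congr rfl fun w _ => ?_
    rcases eq_or_ne w 0 with rfl | hw
    · simp [MulChar.map_zero]
    · refine if_congr ⟨fun h => ?_, fun h => ?_⟩ rfl rfl
      · rw [← h]
        field_simp
        ring
      · field_simp
        linear_combination h
  rw [key]
  rcases eq_or_ne s (-2) with rfl | hs
  · have : (Finset.univ.filter fun w : F => w ^ 2 - -2 * w + 1 = 0) = {-1} := by
      ext w
      simp only [Finset.mem_filter, Finset.mem_univ, true_and, Finset.mem_singleton]
      rw [show w ^ 2 - -2 * w + 1 = (w + 1) ^ 2 by ring, sq_eq_zero_iff, eq_neg_iff_add_eq_zero]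
    rw [this, Finset.sum_singleton, phiChar_neg_one hq, neg_add_cancel, MulChar.map_zero,
      show (-2 - 2 : F) = -4 by norm_num, phiChar_neg hq, h4, zero_add]
  · have hs' : s + 2 ≠ 0 := fun h => hs (eq_neg_of_add_eq_zero_left h)
    -- On the fibre `w(s + 2) = (w + 1)²`, nonzero since `s ≠ -2`, so `φ(w)` depends on `s` alone.
    have hconst : ∀ w ∈ Finset.univ.filter (fun w : F => w ^ 2 - s * w + 1 = 0),
        phiChar F w = phiChar F (s + 2) := by
      intro w hw
      have hw := (Finset.mem_filter.mp hw).2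
      have hw1 : w + 1 ≠ 0 := fun h => by
        have : w = -1 := eq_neg_of_add_eq_zero_left h
        subst this
        exact hs' (by linear_combination hw)
      have h1 : phiChar F (w * (s + 2)) = 1 := by
        rw [show w * (s + 2) = (w + 1) ^ 2 by linear_combination -hw, phiChar_sq hw1]
      rw [map_mul] at h1
      linear_combination phiChar F (s + 2) * h1 - phiChar F w * phiChar_mul_self hs'
    -- Completing the square; the discriminant is `s² - 4`.
    have hcard : (Finset.univ.filter fun w : F => w ^ 2 - s * w + 1 = 0).card =
        (Finset.univ.filter fun r : F => r ^ 2 = (s + 2) * (s - 2)).card := by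
      refine Finset.card_bij' (fun w _ => 2 * w - s) (fun r _ => (r + s) / 2) ?_ ?_ ?_ ?_
      · intro w hw
        simp only [Finset.mem_filter, Finset.mem_univ, true_and] at hw ⊢
        linear_combination 4 * hw
      · intro r hr
        simp only [Finset.mem_filter, Finset.mem_univ, true_and] at hr ⊢
        field_simp
        linear_combination hr
      · intro w _
        field_simp
        ring
      · intro r _
        field_simp
        ring
    rw [Finset.sum_eq_card_nsmul hconst, nsmul_eq_mul, hcard, card_sqrts_eq_phiChar hF, map_mul]
    linear_combination phiChar F (s - 2) * phiChar_mul_self hs'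

theorem sum_phiChar_comp_add_inv (hq : Fintype.card F % 4 = 1) (f : F → ℂ) :
    ∑ w, phiChar F w * f (w + w⁻¹) = ∑ s, (phiChar F (s + 2) + phiChar F (s - 2)) * f s := by
  rw [← Finset.sum_fiberwise Finset.univ (fun w : F => w + w⁻¹)]
  refine Finset.sum_congr rfl fun s _ => ?_
  rw [← sum_phiChar_fiber_add_inv hq, Finset.sum_mul]
  refine Finset.sum_congr rfl fun w hw => ?_
  rw [(Finset.mem_filter.mp hw).2]

/-- Quadratic transformation turning a sum over a quartic character into a sum over the
quadratic character. -/
theorem sum_quartic_comp_add_inv (hq : Fintype.card F % 4 = 1) {χ : MulChar F ℂ}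
    (hχ : orderOf χ = 4) (f : F → ℂ) :
    ∑ v, χ v * f (v + v⁻¹) = ∑ s, phiChar F (s + 2) * f (s ^ 2 - 2) := by
  have hF := ringChar_ne_two_of_card_mod_four hq
  have hχ2 := sq_eq_phiChar_of_orderOf_eq_four hχ
  have hχ2' : ∀ v, χ v ^ 2 = phiChar F v := fun v => by
    rw [← hχ2, MulChar.pow_apply' _ two_ne_zero]
  -- `φχ = χ³ = χ⁻¹`, so the two terms of `1 + φ` are swapped by `v ↦ v⁻¹`.
  have hχinv : ∀ v, phiChar F v * χ v = χ v⁻¹ := by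
    intro v
    rcases eq_or_ne v 0 with rfl | hv
    · simp [MulChar.map_zero]
    · have h1 : χ v * χ v⁻¹ = 1 := by rw [← map_mul, mul_inv_cancel₀ hv, map_one]
      have h2 : (χ v ^ 2) * (χ v ^ 2) = 1 := by rw [hχ2', phiChar_mul_self hv]
      rw [← hχ2']
      linear_combination χ v⁻¹ * h2 - χ v ^ 3 * h1
  have hswap : ∑ v, χ v⁻¹ * f (v + v⁻¹) = ∑ v, χ v * f (v + v⁻¹) := by
    rw [← Equiv.sum_comp (Equiv.inv F)]
    refine Finset.sum_congr rfl fun v _ => ?_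
    simp [add_comm]
  have hL : ∑ w, phiChar F w * f ((w + w⁻¹) ^ 2 - 2) = 2 * ∑ v, χ v * f (v + v⁻¹) := by
    calc ∑ w, phiChar F w * f ((w + w⁻¹) ^ 2 - 2)
        = ∑ w, χ (w ^ 2) * f (w ^ 2 + (w ^ 2)⁻¹) := by
          refine Finset.sum_congr rfl fun w _ => ?_
          rw [map_pow, hχ2']
          rcases eq_or_ne w 0 with rfl | hw
          · simp [MulChar.map_zero]
          · congr 2
            field_simp
            ring
      _ = ∑ v, (1 + phiChar F v) * (χ v * f (v + v⁻¹)) :=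
          sum_comp_sq hF fun v => χ v * f (v + v⁻¹)
      _ = ∑ v, χ v * f (v + v⁻¹) + ∑ v, χ v⁻¹ * f (v + v⁻¹) := by
          rw [← Finset.sum_add_distrib]
          refine Finset.sum_congr rfl fun v _ => ?_
          rw [← hχinv]
          ring
      _ = _ := by rw [hswap, two_mul]
  have hneg : ∑ s, phiChar F (s - 2) * f (s ^ 2 - 2) = ∑ s, phiChar F (s + 2) * f (s ^ 2 - 2) := by
    rw [← Equiv.sum_comp (Equiv.neg F)]
    refine Finset.sum_congr rfl fun s _ => ?_
    rw [Equiv.neg_apply, neg_sq, show -s - 2 = -(s + 2) by ring, phiChar_neg hq]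
  have hR : ∑ w, phiChar F w * f ((w + w⁻¹) ^ 2 - 2) =
      2 * ∑ s, phiChar F (s + 2) * f (s ^ 2 - 2) := by
    rw [sum_phiChar_comp_add_inv hq fun s => f (s ^ 2 - 2)]
    simp only [add_mul]
    rw [Finset.sum_add_distrib, hneg, two_mul]
  exact mul_left_cancel₀ two_ne_zero (hL.symm.trans hR)

end QuadraticCharacter

theorem MulChar.inv_apply_mul_self {F : Type*} [Field F] (D : MulChar F ℂ) {a : F} (ha : a ≠ 0) :
    D⁻¹ a * D a = 1 := by
  rw [← MulChar.mul_apply, inv_mul_cancel, MulChar.one_apply ha.isUnit]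

section Transformation

variable {F : Type*} [Field F] [Fintype F] [DecidableEq F]

/-- With `v = z²y`, `(y - 1)(1 - z⁴y)/y = z²(z² + z⁻² - v - v⁻¹)`. The factor `φ(z)` is `χ(z²)`, and
`D⁴(z - 1)` is absorbed as the denominator. -/
theorem quartic_hyp2F1_sum (hq : Fintype.card F % 4 = 1) {χ : MulChar F ℂ} (hχ : orderOf χ = 4)
    {z : F} (hz : z ≠ 0) (hz1 : z - 1 ≠ 0) (D : MulChar F ℂ) :
    (D ^ 4) (z - 1) * ∑ y, (D * χ) y * ((D * χ)⁻¹ * χ) (y - 1) * D⁻¹ (1 - z ^ 4 * y) =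
      phiChar F z * ∑ s, phiChar F (s + 2) *
        D⁻¹ (z ^ 2 * ((z + z⁻¹) ^ 2 - s ^ 2) / (z - 1) ^ 4) := by
  have hχz : χ (z ^ 2) * phiChar F z = 1 := by
    rw [map_pow, ← MulChar.pow_apply' _ two_ne_zero, sq_eq_phiChar_of_orderOf_eq_four hχ,
      phiChar_mul_self hz]
  have hz2 : z ^ 2 ≠ 0 := pow_ne_zero 2 hz
  have := sum_quartic_comp_add_inv hq hχ
    fun t => D⁻¹ (z ^ 2 * ((z + z⁻¹) ^ 2 - 2 - t) / (z - 1) ^ 4)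
  have h' : ∀ s : F, (z + z⁻¹) ^ 2 - 2 - (s ^ 2 - 2) = (z + z⁻¹) ^ 2 - s ^ 2 := fun s => by ring
  simp only [h'] at this
  have hinv : (D * χ)⁻¹ * χ = D⁻¹ := by rw [mul_comm D, mul_inv, mul_comm χ⁻¹, inv_mul_cancel_right]
  rw [← this, hinv, ← Equiv.sum_comp (Equiv.mulLeft₀ (z ^ 2) hz2) fun v =>
    χ v * D⁻¹ (z ^ 2 * ((z + z⁻¹) ^ 2 - 2 - (v + v⁻¹)) / (z - 1) ^ 4), Finset.mul_sum,
    Finset.mul_sum]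
  refine Finset.sum_congr rfl fun y _ => ?_
  rw [Equiv.mulLeft₀_apply]
  rcases eq_or_ne y 0 with rfl | hy
  · simp [MulChar.map_zero]
  have harg : z ^ 2 * ((z + z⁻¹) ^ 2 - 2 - (z ^ 2 * y + (z ^ 2 * y)⁻¹)) / (z - 1) ^ 4 * (z - 1) ^ 4
      * y = (y - 1) * (1 - z ^ 4 * y) := by
    field_simp
    ring
  generalize z ^ 2 * ((z + z⁻¹) ^ 2 - 2 - (z ^ 2 * y + (z ^ 2 * y)⁻¹)) / (z - 1) ^ 4 = T
    at harg ⊢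
  have hD : D⁻¹ T * D⁻¹ ((z - 1) ^ 4) * D⁻¹ y = D⁻¹ (y - 1) * D⁻¹ (1 - z ^ 4 * y) := by
    rw [← map_mul, ← map_mul, harg, map_mul]
  have h1 := D.inv_apply_mul_self (pow_ne_zero 4 hz1)
  have h2 := D.inv_apply_mul_self hy
  rw [MulChar.pow_apply' _ (by norm_num), ← map_pow, map_mul χ, MulChar.mul_apply]
  linear_combination D ((z - 1) ^ 4) * D y * χ y * (-hD)
    + D⁻¹ T * χ y * (D⁻¹ y * D y * h1 + h2) - χ y * D⁻¹ T * hχz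

theorem quadratic_hyp2F1_sum (hq : Fintype.card F % 4 = 1) {z : F} (hz : z ≠ 0) (hz1 : z - 1 ≠ 0)
    (D : MulChar F ℂ) :
    ∑ y, (D ^ 2 * phiChar F) y * ((D ^ 2 * phiChar F)⁻¹ * (D * phiChar F)) (y - 1) *
        D⁻¹ (1 - -(((z + 1) / (z - 1)) ^ 2) * y) =
      phiChar F z * ∑ s, phiChar F (s + 2) *
        D⁻¹ (z ^ 2 * ((z + z⁻¹) ^ 2 - s ^ 2) / (z - 1) ^ 4) := by
  have hc : -(z / (z - 1) ^ 2) ≠ 0 := neg_ne_zero.mpr (div_ne_zero hz (pow_ne_zero 2 hz1))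
  have hφc : phiChar F (-(z / (z - 1) ^ 2)) = phiChar F z := by
    rw [phiChar_neg hq, div_eq_mul_inv, map_mul, phiChar_inv, phiChar_sq hz1, mul_one]
  have hinv : (D ^ 2 * phiChar F)⁻¹ * (D * phiChar F) = D⁻¹ := by
    rw [mul_inv, sq, mul_inv]
    have := inv_mul_cancel (phiChar F)
    calc _ = D⁻¹ * (D⁻¹ * D) * ((phiChar F)⁻¹ * phiChar F) := by ac_rfl
      _ = D⁻¹ := by rw [inv_mul_cancel, inv_mul_cancel, mul_one, mul_one]
  -- Substitute `y = u⁻¹` with `u = -z(s + 2)/(z - 1)²`; then the zeros `u = 1` and `u = x` of the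
  -- argument of `D⁻¹` sit at `s = ∓(z + z⁻¹)`.
  rw [hinv, ← Equiv.sum_comp (Equiv.inv F), ← Equiv.sum_comp
    ((Equiv.addRight 2).trans (Equiv.mulLeft₀ (-(z / (z - 1) ^ 2)) hc)), Finset.mul_sum]
  refine Finset.sum_congr rfl fun s _ => ?_
  simp only [Equiv.trans_apply, Equiv.coe_addRight, Equiv.mulLeft₀_apply, Equiv.inv_apply]
  have hu : phiChar F (-(z / (z - 1) ^ 2) * (s + 2)) = phiChar F z * phiChar F (s + 2) := by
    rw [map_mul, hφc]
  rw [← mul_assoc, ← hu]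
  have hval : z ^ 2 * ((z + z⁻¹) ^ 2 - s ^ 2) / (z - 1) ^ 4 =
      (1 - -(z / (z - 1) ^ 2) * (s + 2)) *
        (-(z / (z - 1) ^ 2) * (s + 2) - -(((z + 1) / (z - 1)) ^ 2)) := by
    field_simp
    ring
  rw [hval]
  generalize -(z / (z - 1) ^ 2) * (s + 2) = u
  generalize -(((z + 1) / (z - 1)) ^ 2) = x
  rcases eq_or_ne u 0 with rfl | h0
  · simp [MulChar.map_zero]
  have harg : (1 - u) * (u - x) = (u⁻¹ - 1) * (1 - x * u⁻¹) * u ^ 2 := by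
    field_simp
  have hDu : D u⁻¹ * D u = 1 := by rw [← map_mul, inv_mul_cancel₀ h0, map_one]
  have hDi : D⁻¹ u = D u⁻¹ := MulChar.inv_apply' D u
  rw [harg, map_mul, map_mul, MulChar.mul_apply, MulChar.pow_apply' _ two_ne_zero, phiChar_inv,
    map_pow, hDi]
  ring

end Transformation

theorem theorem3 {F : Type*} [Field F] [Fintype F] [DecidableEq F]
    (hq : Fintype.card F % 4 = 1) :
    (∃ χ : MulChar F ℂ, orderOf χ = 4) ∧
    ∀ χ₄ : MulChar F ℂ, orderOf χ₄ = 4 →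
      ∀ z : F, z ≠ 0 → z ≠ 1 → z ≠ -1 →
        ∀ D : MulChar F ℂ,
          (D ^ 4) (z - 1) * hyp2F1 D (D * χ₄) χ₄ (z ^ 4) =
            hyp2F1 D (D ^ 2 * phiChar F) (D * phiChar F) (-(((z + 1) / (z - 1)) ^ 2)) := by
  refine ⟨exists_mulChar_orderOf_eq_four F hq, fun χ hχ z hz hz1 hz2 D => ?_⟩
  have hz1' : z - 1 ≠ 0 := sub_ne_zero.mpr hz1
  have hx : -(((z + 1) / (z - 1)) ^ 2) ≠ 0 :=
    neg_ne_zero.mpr (pow_ne_zero 2 (div_ne_zero (fun h => hz2 (eq_neg_of_add_eq_zero_left h)) hz1'))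
  rw [hyp2F1, hyp2F1, MulChar.one_apply (pow_ne_zero 4 hz).isUnit, MulChar.one_apply hx.isUnit,
    mul_left_comm, quartic_hyp2F1_sum hq hχ hz hz1' D, quadratic_hyp2F1_sum hq hz hz1' D]
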